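/- Let $n,d,w$ be integers with $2\le d\le w\le n/2$. Let $A(n,2d,w)$ be the maximum number of codewords in a binary code of length $n$ all of whose codewords have Hamming weight $w$ and whose distinct codewords are at Hamming distance at least $2d$. Let $\mathbb F_2(n,w)$ be the set of binary vectors of length $n$ and weight $w$ (so $|\mathbb F_2(n,w)|=\binom nw$), and let $$V(n,r,w)=\sum_{i=0}^{r}\binom wi\binom{n-w}{i}$$ be the volume of a sphere of radius $r$ in the Johnson metric on $\mathbb F_2(n,w)$. For positive integers $i,j,k\le w$ with $k\le i+j$ define $$p^k_{i,j}=\sum_{l=a}^{b}\binom{n-w-k}{l}\binom{k}{i-l}\binom{k}{j-l}\binom{w-k}{i+j-k-l},$$ $$a=\max\{0,\,i-k,\,j-k,\,i+j-w\},\qquad b=\min\{i,\,j,\,i+j-k,\,n-w-k\},$$ and put $p^k_{i,j}=0$ for $k>i+j$. For $1\le r\le w$ let $$e(n,r,w)=\frac16\sum_{i=1}^{r}\sum_{j=1}^{r}\sum_{k=1}^{r}\binom wk\binom{n-w}{k}\,p^k_{i,j}.$$ Then $$A(n,2d,w)\ \ge\ \frac{|\mathbb F_2(n,w)|}{V(n,d-1,w)}\cdot\frac{\log_2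 V(n,d-1,w)-\log_2\sqrt{e(n,d-1,w)}}{10}.$$ -/

import Mathlib

/-- `F₂(n, w)`: the set of binary vectors of length `n` and Hamming weight `w`. -/
def constWeightVectors (n w : ℕ) : Finset (Fin n → ZMod 2) :=
  Finset.univ.filter fun x => hammingNorm x = w

/-- `C` is a binary code of length `n`, constant weight `w`, in which distinct codewords
have Hamming distance at least `δ`. -/
def IsConstWeightCode (n δ w : ℕ) (C : Finset (Fin n → ZMod 2)) : Prop :=
  C ⊆ constWeightVectors n w ∧ ∀ x ∈ C, ∀ y ∈ C, x ≠ y → δ ≤ hammingDist x y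

instance (n δ w : ℕ) : DecidablePred (IsConstWeightCode n δ w) := fun C => by
  unfold IsConstWeightCode
  infer_instance

/-- `A(n, δ, w)`: the maximum number of codewords in a binary code of length `n`, constant
weight `w` and minimum Hamming distance (at least) `δ`. The empty code qualifies, so this is a
maximum over a nonempty finite family. -/
def maxConstWeightCode (n δ w : ℕ) : ℕ :=
  (Finset.univ.filter (IsConstWeightCode n δ w)).sup Finset.card

/-- `V(n, r, w)`: the volume of a sphere of radius `r` in the Johnson metric (half the Hamming
distance) on the binary vectors of length `n` and weight `w`. -/
def johnsonVolume (n r w : ℕ) : ℕ :=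
  ∑ i ∈ Finset.range (r + 1), w.choose i * (n - w).choose i

/-- The number `p^k_{i,j}` (for fixed `n`, `w` with `2 * w ≤ n`, and `i, j, k ≤ w`). The
truncated subtractions in the lower summation limit agree with the integer ones because `0` is
one of the terms of the maximum; all the others are genuine, by `k ≤ w ≤ n - w`, `k ≤ i + j`
and the upper summation limit. -/
def johnsonIntersection (n w i j k : ℕ) : ℕ :=
  if k ≤ i + j then
    ∑ l ∈ Finset.Icc
        (max 0 (max (i - k) (max (j - k) (i + j - w))))
        (min i (min j (min (i + j - k) (n - w - k)))),
      (n - w - k).choose l * k.choose (i - l) * k.choose (j - l) *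
        (w - k).choose (i + j - k - l)
  else 0

/-- The quantity `e(n, r, w)`. -/
noncomputable def johnsonE (n r w : ℕ) : ℝ :=
  (1 / 6 : ℝ) * ∑ i ∈ Finset.Icc 1 r, ∑ j ∈ Finset.Icc 1 r, ∑ k ∈ Finset.Icc 1 r,
    (w.choose k : ℝ) * ((n - w).choose k : ℝ) * (johnsonIntersection n w i j k : ℝ)

/-! Identify words with their supports and join two `w`-sets at Johnson distance between `1` and `d
- 1`; independent sets of this graph are codes of distance `2d`. Closed neighbourhoods have at most
`V` elements (`card_johnson_neighbors_succ_le`), so a greedy choice gives `|A| / V`, where `A` is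
the family of all `w`-sets. The logarithm comes from sparsity: a neighbourhood contains at most `6e`
ordered adjacent pairs (`sum_card_johnson_triangles_le`).

Draw an independent set `S` with probability proportional to `c ^ |S|`, where `c = 1 / (4√e)`, and
put `L = log₂ (V / √e)`. For `L ≥ 10`, the expectation of `V · 1[v ∈ S] + |S ∩ N(v)|` is at least `L
/ 5` for every vertex `v`. To see this, fix `S` outside the closed neighbourhood of `v`. What
remains is either `{v}` or an independent subset of the set `U` of unblocked neighbours. If `U` is
large, its sparsity forces many chosen neighbours; if `U` is small, so is its partition function,
and `v` is chosen often enough for the weight `V` to pay (`local_occupancy_of_sparse`). Summed over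
`v`, a chosen vertex counts at most `2V` times, so some `S` has at least `|A| L / (10 V)` elements
(`exists_indepSubset_of_local_occupancy`). -/

/-- The independent sets of `G` contained in the finite vertex set `A`. -/
def indepSubsets {α : Type*} [DecidableEq α] (G : SimpleGraph α) [DecidableRel G.Adj]
    (A : Finset α) : Finset (Finset α) :=
  A.powerset.filter fun S => ∀ x ∈ S, ∀ y ∈ S, ¬ G.Adj x y

/-- The partition function of the hard-core model with fugacity `c` on `A`. -/
def hardCoreSum {α : Type*} [DecidableEq α] (G : SimpleGraph α) [DecidableRel G.Adj]
    (c : ℝ) (A : Finset α) : ℝ :=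
  ∑ S ∈ indepSubsets G A, c ^ S.card

/-! ### Hard-core model: occupation probabilities -/

section HardCore

variable {α : Type*} [DecidableEq α] (G : SimpleGraph α) [DecidableRel G.Adj]

theorem mem_indepSubsets {A S : Finset α} :
    S ∈ indepSubsets G A ↔ S ⊆ A ∧ ∀ x ∈ S, ∀ y ∈ S, ¬ G.Adj x y := by
  simp [indepSubsets]

theorem empty_mem_indepSubsets (A : Finset α) : ∅ ∈ indepSubsets G A := by
  simp [mem_indepSubsets]

theorem hardCoreSum_pos {c : ℝ} (hc : 0 < c) (A : Finset α) : 0 < hardCoreSum G c A :=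
  Finset.sum_pos (fun _ _ => pow_pos hc _) ⟨∅, empty_mem_indepSubsets G A⟩

theorem hardCoreSum_le_pow {c : ℝ} (hc : 0 < c) (A : Finset α) :
    hardCoreSum G c A ≤ (1 + c) ^ A.card := by
  have h := Finset.sum_pow_mul_eq_add_pow c 1 A
  simp only [one_pow, mul_one] at h
  rw [add_comm, ← h]
  exact Finset.sum_le_sum_of_subset_of_nonneg (Finset.filter_subset _ _)
    (fun _ _ _ => (pow_pos hc _).le)

/-- Erasing `u` is a bijection onto the independent sets that avoid `u` and its neighbours, and it
costs one factor `c`. -/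
theorem sum_indepSubsets_mem {c : ℝ} {A : Finset α} {u : α} (hu : u ∈ A) :
    ∑ S ∈ indepSubsets G A with u ∈ S, c ^ S.card =
      c * ∑ S ∈ indepSubsets G A with ∀ x ∈ S, x ≠ u ∧ ¬ G.Adj u x, c ^ S.card := by
  rw [Finset.mul_sum]
  refine Finset.sum_nbij' (fun S => S.erase u) (fun S => insert u S) ?_ ?_ ?_ ?_ ?_
  · intro S hS
    simp only [Finset.mem_filter, mem_indepSubsets] at hS ⊢
    obtain ⟨⟨hA, hI⟩, huS⟩ := hS
    refine ⟨⟨(Finset.erase_subset _ _).trans hA, fun x hx y hy =>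
      hI x (Finset.mem_of_mem_erase hx) y (Finset.mem_of_mem_erase hy)⟩, fun x hx =>
      ⟨Finset.ne_of_mem_erase hx, hI u huS x (Finset.mem_of_mem_erase hx)⟩⟩
  · intro S hS
    simp only [Finset.mem_filter, mem_indepSubsets] at hS ⊢
    obtain ⟨⟨hA, hI⟩, huS⟩ := hS
    refine ⟨⟨Finset.insert_subset hu hA, ?_⟩, Finset.mem_insert_self _ _⟩
    simp only [Finset.forall_mem_insert]
    exact ⟨⟨G.irrefl, fun y hy => (huS y hy).2⟩, fun x hx =>
      ⟨fun h => (huS x hx).2 h.symm, hI x hx⟩⟩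
  · intro S hS
    exact Finset.insert_erase (Finset.mem_filter.1 hS).2
  · intro S hS
    exact Finset.erase_insert fun h => ((Finset.mem_filter.1 hS).2 u h).1 rfl
  · intro S hS
    rw [← pow_succ', Finset.card_erase_add_one (Finset.mem_filter.1 hS).2]

/-- With `P = c Q` from the erasing bijection, the two families are disjoint, so `P + Q` is at most
the partition function. -/
theorem sum_indepSubsets_mem_le {c : ℝ} (hc : 0 < c) {A : Finset α} {u : α} (hu : u ∈ A) :
    ∑ S ∈ indepSubsets G A with u ∈ S, c ^ S.card ≤ c / (1 + c) * hardCoreSum G c A := by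
  have h := sum_indepSubsets_mem G (c := c) hu
  set P := ∑ S ∈ indepSubsets G A with u ∈ S, c ^ S.card
  set Q := ∑ S ∈ indepSubsets G A with ∀ x ∈ S, x ≠ u ∧ ¬ G.Adj u x, c ^ S.card with hQ
  have hle : P + Q ≤ hardCoreSum G c A := by
    unfold hardCoreSum
    rw [← Finset.sum_filter_add_sum_filter_not (indepSubsets G A) (fun S => u ∈ S)]
    refine add_le_add le_rfl (Finset.sum_le_sum_of_subset_of_nonneg ?_
      fun _ _ _ => (pow_pos hc _).le)
    intro S hS
    simp only [Finset.mem_filter] at hS ⊢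
    exact ⟨hS.1, fun h => (hS.2 u h).1 rfl⟩
  rw [div_mul_eq_mul_div, le_div_iff₀ (by linarith)]
  nlinarith

/-- An independent set contains `u`, or avoids `u` and all its neighbours, or contains a neighbour
of `u`. The upper bound on occupation probabilities controls the third case, one neighbour at a
time. -/
theorem le_sum_indepSubsets_mem {c : ℝ} (hc : 0 < c) {A : Finset α} {u : α} (hu : u ∈ A) :
    c / (1 + c) * (1 - c / (1 + c) * ((A.filter fun y => G.Adj u y).card : ℝ)) *
        hardCoreSum G c A ≤
      ∑ S ∈ indepSubsets G A with u ∈ S, c ^ S.card := by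
  have h := sum_indepSubsets_mem G (c := c) hu
  set P := ∑ S ∈ indepSubsets G A with u ∈ S, c ^ S.card
  set Q := ∑ S ∈ indepSubsets G A with ∀ x ∈ S, x ≠ u ∧ ¬ G.Adj u x, c ^ S.card with hQ
  have hcover : hardCoreSum G c A ≤ P + Q + ∑ y ∈ A with G.Adj u y,
      ∑ S ∈ indepSubsets G A with y ∈ S, c ^ S.card := by
    have hsub : indepSubsets G A ⊆ ((indepSubsets G A).filter (fun S => u ∈ S) ∪
        (indepSubsets G A).filter (fun S => ∀ x ∈ S, x ≠ u ∧ ¬ G.Adj u x)) ∪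
        (A.filter fun y => G.Adj u y).biUnion
          (fun y => (indepSubsets G A).filter (fun S => y ∈ S)) := by
      intro S hS
      by_cases huS : u ∈ S
      · simp [hS, huS]
      by_cases hy : ∃ y ∈ S, G.Adj u y
      · obtain ⟨y, hyS, hy⟩ := hy
        refine Finset.mem_union_right _ (Finset.mem_biUnion.2 ⟨y, ?_, ?_⟩)
        · exact Finset.mem_filter.2 ⟨((mem_indepSubsets G).1 hS).1 hyS, hy⟩
        · exact Finset.mem_filter.2 ⟨hS, hyS⟩
      · push Not at hy
        refine Finset.mem_union_left _ (Finset.mem_union_right _ (Finset.mem_filter.2 ⟨hS, ?_⟩))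
        exact fun x hx => ⟨fun h => huS (h ▸ hx), hy x hx⟩
    have hnn : ∀ S : Finset α, 0 ≤ c ^ S.card := fun S => (pow_pos hc _).le
    have hunion : ∀ s t : Finset (Finset α), ∑ S ∈ s ∪ t, c ^ S.card ≤
        ∑ S ∈ s, c ^ S.card + ∑ S ∈ t, c ^ S.card := fun s t => by
      rw [← Finset.sum_union_inter]
      linarith [Finset.sum_nonneg (s := s ∩ t) fun S _ => hnn S]
    refine (Finset.sum_le_sum_of_subset_of_nonneg hsub fun S _ _ => hnn S).trans ?_
    refine (hunion _ _).trans (add_le_add (hunion _ _) ?_)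
    induction A.filter fun y => G.Adj u y using Finset.induction_on with
    | empty => simp
    | insert y t hy ih =>
      rw [Finset.biUnion_insert, Finset.sum_insert hy]
      exact (hunion _ _).trans (add_le_add le_rfl ih)
  have hnb : ∑ y ∈ A with G.Adj u y, ∑ S ∈ indepSubsets G A with y ∈ S, c ^ S.card ≤
      ((A.filter fun y => G.Adj u y).card : ℝ) * (c / (1 + c) * hardCoreSum G c A) := by
    rw [← nsmul_eq_mul]
    exact Finset.sum_le_card_nsmul _ _ _ fun y hy =>
      sum_indepSubsets_mem_le G hc (Finset.mem_filter.1 hy).1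
  have h1 : 0 < 1 + c := by linarith
  have hP : c / (1 + c) * (P + Q) = P := by
    rw [h]; field_simp; ring
  have := mul_le_mul_of_nonneg_left (hcover.trans (add_le_add le_rfl hnb)) (div_pos hc h1).le
  rw [mul_add, hP] at this
  linarith

/-- The expected size of a hard-core independent set on a vertex set spanning few edges. -/
theorem le_sum_card_indepSubsets {c f : ℝ} (hc : 0 < c) {A : Finset α}
    (hf : ((∑ u ∈ A, (A.filter fun y => G.Adj u y).card : ℕ) : ℝ) ≤ f) :
    c / (1 + c) * (A.card - c / (1 + c) * f) * hardCoreSum G c A ≤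
      ∑ S ∈ indepSubsets G A, (S.card : ℝ) * c ^ S.card := by
  have h1 : ∑ S ∈ indepSubsets G A, (S.card : ℝ) * c ^ S.card =
      ∑ u ∈ A, ∑ S ∈ indepSubsets G A with u ∈ S, c ^ S.card := by
    simp_rw [Finset.sum_filter]
    rw [Finset.sum_comm]
    refine Finset.sum_congr rfl fun S hS => ?_
    rw [← Finset.sum_filter, Finset.filter_mem_eq_inter,
      Finset.inter_eq_right.2 ((mem_indepSubsets G).1 hS).1, Finset.sum_const, nsmul_eq_mul]
  rw [h1]
  refine le_trans ?_ (Finset.sum_le_sum fun u hu => le_sum_indepSubsets_mem G hc hu)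
  rw [← Finset.sum_mul, ← Finset.mul_sum, Finset.sum_sub_distrib, ← Finset.mul_sum]
  have hμ : 0 < c / (1 + c) := by positivity
  have hZ := hardCoreSum_pos G hc A
  push_cast at hf
  simp only [Finset.sum_const, nsmul_eq_mul, mul_one]
  gcongr

end HardCore

/-! ### From local occupancy to a large independent set -/

section LocalOccupancy

variable {α : Type*} [DecidableEq α] (G : SimpleGraph α) [DecidableRel G.Adj]

/-- Summation over the independent sets with a prescribed trace outside the closed
neighbourhood of `v`. -/
theorem sum_indepSubsets_sdiff_eq {A J : Finset α} {v : α} (hv : v ∈ A)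
    (hJ : J ∈ indepSubsets G (A \ insert v (A.filter (G.Adj v)))) (g : Finset α → ℝ) :
    ∑ S ∈ indepSubsets G A with S \ insert v (A.filter (G.Adj v)) = J, g S =
      g (insert v J) +
        ∑ I ∈ indepSubsets G ((A.filter (G.Adj v)).filter fun u => ∀ y ∈ J, ¬ G.Adj u y),
          g (J ∪ I) := by
  rw [mem_indepSubsets] at hJ
  obtain ⟨hJA, hJI⟩ := hJ
  have hJ' : ∀ x ∈ J, x ∈ A ∧ x ≠ v ∧ ¬ G.Adj v x := fun x hx => by
    have := hJA hx
    simp only [Finset.mem_sdiff, Finset.mem_insert, Finset.mem_filter, not_or, not_and] at this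
    exact ⟨this.1, this.2.1, this.2.2 this.1⟩
  set U := (A.filter (G.Adj v)).filter fun u => ∀ y ∈ J, ¬ G.Adj u y with hU
  have hmemU : ∀ x, x ∈ U ↔ x ∈ A ∧ G.Adj v x ∧ ∀ y ∈ J, ¬ G.Adj x y := fun x => by
    simp [hU, and_assoc]
  have hdisj : ∀ I ∈ indepSubsets G U, Disjoint J I := fun I hI =>
    Finset.disjoint_left.2 fun x hxJ hxI =>
      (hJ' x hxJ).2.2 ((hmemU x).1 (((mem_indepSubsets G).1 hI).1 hxI)).2.1
  have hset : (indepSubsets G A).filter (fun S => S \ insert v (A.filter (G.Adj v)) = J) =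
      insert (insert v J) ((indepSubsets G U).image fun I => J ∪ I) := by
    ext S
    simp only [Finset.mem_filter, Finset.mem_insert, Finset.mem_image, mem_indepSubsets]
    constructor
    · rintro ⟨⟨hSA, hSI⟩, rfl⟩
      -- If `v ∈ S`, independence empties the neighbourhood of `v`; otherwise the neighbours in `S`
      -- form an independent set of vertices not blocked by `J`.
      by_cases hvS : v ∈ S
      · left
        ext x
        simp only [Finset.mem_insert, Finset.mem_sdiff, Finset.mem_filter, not_or, not_and]
        constructor
        · intro hx
          by_cases hxv : x = v
          · exact Or.inl hxv
          · exact Or.inr ⟨hx, hxv, fun _ => hSI v hvS x hx⟩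
        · rintro (rfl | h)
          · exact hvS
          · exact h.1
      · right
        refine ⟨S.filter (G.Adj v), ⟨?_, ?_⟩, ?_⟩
        · intro x hx
          rw [Finset.mem_filter] at hx
          exact (hmemU x).2 ⟨hSA hx.1, hx.2, fun y hy => hSI x hx.1 y (Finset.mem_sdiff.1 hy).1⟩
        · exact fun x hx y hy => hSI x (Finset.mem_filter.1 hx).1 y (Finset.mem_filter.1 hy).1
        · ext x
          simp only [Finset.mem_union, Finset.mem_insert, Finset.mem_sdiff, Finset.mem_filter,
            not_or, not_and]
          constructor
          · rintro (h | h)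
            · exact h.1
            · exact h.1
          · intro hx
            by_cases hvx : G.Adj v x
            · exact Or.inr ⟨hx, hvx⟩
            · exact Or.inl ⟨hx, fun h => hvS (h ▸ hx), fun _ => hvx⟩
    · rintro (rfl | ⟨I, ⟨hIU, hII⟩, rfl⟩)
      · refine ⟨⟨Finset.insert_subset hv fun x hx => (hJ' x hx).1, ?_⟩, ?_⟩
        · simp only [Finset.forall_mem_insert]
          exact ⟨⟨G.irrefl, fun y hy => (hJ' y hy).2.2⟩, fun x hx =>
            ⟨fun h => (hJ' x hx).2.2 h.symm, hJI x hx⟩⟩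
        · ext x
          simp only [Finset.mem_insert, Finset.mem_sdiff, Finset.mem_filter, not_or, not_and]
          constructor
          · rintro ⟨h | h, h'⟩
            · exact absurd h h'.1
            · exact h
          · exact fun hx => ⟨Or.inr hx, (hJ' x hx).2.1, fun _ => (hJ' x hx).2.2⟩
      · refine ⟨⟨Finset.union_subset (fun x hx => (hJ' x hx).1)
          fun x hx => ((hmemU x).1 (hIU hx)).1, ?_⟩, ?_⟩
        · intro x hx y hy
          rcases Finset.mem_union.1 hx with hx | hx <;> rcases Finset.mem_union.1 hy with hy | hy
          · exact hJI x hx y hy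
          · exact fun h => ((hmemU y).1 (hIU hy)).2.2 x hx h.symm
          · exact ((hmemU x).1 (hIU hx)).2.2 y hy
          · exact hII x hx y hy
        · ext x
          simp only [Finset.mem_insert, Finset.mem_sdiff, Finset.mem_filter, not_or, not_and,
            Finset.mem_union]
          constructor
          · rintro ⟨h | h, h'⟩
            · exact h
            · have := (hmemU x).1 (hIU h)
              exact absurd this.2.1 (h'.2 this.1)
          · exact fun hx => ⟨Or.inl hx, (hJ' x hx).2.1, fun _ => (hJ' x hx).2.2⟩
  rw [hset, Finset.sum_insert, Finset.sum_image]
  · intro I hI I' hI' h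
    have h1 := Finset.union_sdiff_cancel_left (hdisj I hI)
    have h2 := Finset.union_sdiff_cancel_left (hdisj I' hI')
    dsimp only at h
    rw [← h1, ← h2, h]
  · simp only [Finset.mem_image, not_exists, not_and]
    intro I hI h
    have : v ∈ J ∪ I := h ▸ Finset.mem_insert_self v J
    rcases Finset.mem_union.1 this with h | h
    · exact (hJ' v h).2.1 rfl
    · exact G.irrefl ((hmemU v).1 (((mem_indepSubsets G).1 hI).1 h)).2.1

/-- A local occupancy estimate, averaged over all independent sets. -/
theorem sum_local_occupancy_nonneg {c a m : ℝ} (hc : 0 < c) {A : Finset α} {v : α} (hv : v ∈ A)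
    (hloc : ∀ U ⊆ A.filter (G.Adj v), m * (c + hardCoreSum G c U) ≤
      a * c + ∑ I ∈ indepSubsets G U, (I.card : ℝ) * c ^ I.card) :
    0 ≤ ∑ S ∈ indepSubsets G A, c ^ S.card *
      ((if v ∈ S then a else 0) + ((S.filter (G.Adj v)).card : ℝ) - m) := by
  have hmaps : ∀ S ∈ indepSubsets G A, S \ insert v (A.filter (G.Adj v)) ∈
      indepSubsets G (A \ insert v (A.filter (G.Adj v))) := fun S hS => by
    rw [mem_indepSubsets] at hS ⊢
    exact ⟨Finset.sdiff_subset_sdiff hS.1 le_rfl, fun x hx y hy =>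
      hS.2 x (Finset.mem_sdiff.1 hx).1 y (Finset.mem_sdiff.1 hy).1⟩
  rw [← Finset.sum_fiberwise_of_maps_to hmaps]
  -- The fibre over the trace `J` contributes `c ^ |J|` times the slack in `hloc` for the set `U` of
  -- neighbours not blocked by `J`.
  refine Finset.sum_nonneg fun J hJ => ?_
  rw [sum_indepSubsets_sdiff_eq G hv hJ]
  have hJA := ((mem_indepSubsets G).1 hJ).1
  have hJ' : ∀ x ∈ J, x ≠ v ∧ ¬ G.Adj v x := fun x hx => by
    have := hJA hx
    simp only [Finset.mem_sdiff, Finset.mem_insert, Finset.mem_filter, not_or, not_and] at this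
    exact ⟨this.2.1, this.2.2 this.1⟩
  have hvJ : v ∉ J := fun h => (hJ' v h).1 rfl
  have hfJ : J.filter (G.Adj v) = ∅ := Finset.filter_eq_empty_iff.2 fun x hx => (hJ' x hx).2
  set U := (A.filter (G.Adj v)).filter fun u => ∀ y ∈ J, ¬ G.Adj u y with hU
  have hterm : ∀ I ∈ indepSubsets G U, c ^ (J ∪ I).card *
      ((if v ∈ J ∪ I then a else 0) + (((J ∪ I).filter (G.Adj v)).card : ℝ) - m) =
      c ^ J.card * ((I.card : ℝ) * c ^ I.card) - c ^ J.card * (m * c ^ I.card) := by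
    intro I hI
    have hIU := ((mem_indepSubsets G).1 hI).1
    have hI' : ∀ x ∈ I, G.Adj v x := fun x hx =>
      (Finset.mem_filter.1 (Finset.mem_filter.1 (hIU hx)).1).2
    have hvI : v ∉ I := fun h => G.irrefl (hI' v h)
    have hd : Disjoint J I := Finset.disjoint_left.2 fun x hxJ hxI => (hJ' x hxJ).2 (hI' x hxI)
    rw [Finset.card_union_of_disjoint hd, Finset.filter_union, hfJ, Finset.empty_union,
      Finset.filter_true_of_mem hI', if_neg (by simp [hvJ, hvI]), pow_add]
    ring
  rw [Finset.sum_congr rfl hterm, Finset.sum_sub_distrib, ← Finset.mul_sum, ← Finset.mul_sum,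
    ← Finset.mul_sum, Finset.card_insert_of_notMem hvJ, if_pos (Finset.mem_insert_self _ _),
    Finset.filter_insert, if_neg G.irrefl, hfJ, pow_succ]
  have h := hloc U (Finset.filter_subset _ _)
  have hp : 0 < c ^ J.card := pow_pos hc _
  unfold hardCoreSum at h
  have := mul_le_mul_of_nonneg_left h hp.le
  simp only [Finset.card_empty, Nat.cast_zero]
  linarith

/-- A local occupancy estimate yields a large independent set. -/
theorem exists_indepSubset_of_local_occupancy {c a m D : ℝ} (hc : 0 < c) {A : Finset α}
    (hD : ∀ v ∈ A, ((A.filter (G.Adj v)).card : ℝ) ≤ D)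
    (hloc : ∀ v ∈ A, ∀ U ⊆ A.filter (G.Adj v), m * (c + hardCoreSum G c U) ≤
      a * c + ∑ I ∈ indepSubsets G U, (I.card : ℝ) * c ^ I.card) :
    ∃ S ∈ indepSubsets G A, A.card * m ≤ (a + D) * S.card := by
  by_contra! hcon
  have h0 := Finset.sum_nonneg fun v hv => sum_local_occupancy_nonneg G hc hv (hloc v hv)
  rw [Finset.sum_comm] at h0
  refine absurd h0 (not_le.2 (Finset.sum_neg (fun S hS => ?_) ⟨∅, empty_mem_indepSubsets G A⟩))
  have hSA := ((mem_indepSubsets G).1 hS).1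
  rw [← Finset.mul_sum]
  refine mul_neg_of_pos_of_neg (pow_pos hc _) ?_
  have h1 : ∑ v ∈ A, (if v ∈ S then a else 0) = a * S.card := by
    rw [← Finset.sum_filter, Finset.filter_mem_eq_inter, Finset.inter_eq_right.2 hSA,
      Finset.sum_const, nsmul_eq_mul, mul_comm]
  -- Double counting: each `u ∈ S` is counted once for each of its neighbours in `A`.
  have h2 : ∑ v ∈ A, ((S.filter (G.Adj v)).card : ℝ) ≤ D * S.card := by
    have : ∑ v ∈ A, (S.filter (G.Adj v)).card = ∑ u ∈ S, (A.filter (G.Adj u)).card := by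
      simp_rw [Finset.card_filter]
      rw [Finset.sum_comm]
      simp_rw [G.adj_comm]
    rw [← Nat.cast_sum, this, Nat.cast_sum, mul_comm, ← nsmul_eq_mul]
    exact Finset.sum_le_card_nsmul _ _ _ fun u hu => hD u (hSA hu)
  rw [Finset.sum_sub_distrib, Finset.sum_add_distrib, h1, Finset.sum_const, nsmul_eq_mul]
  linarith [hcon S hS]

end LocalOccupancy

/-! ### Independent sets in locally sparse graphs -/

section LocallySparse

variable {α : Type*} [DecidableEq α] (G : SimpleGraph α) [DecidableRel G.Adj]

/-- Tangent line of `2 ^ (L / 2)` at `L = 10`, where the value is `32`, with the slope `16 log 2`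
lowered to `11`. -/
theorem exp_half_log_two_mul_ge {L : ℝ} (hL : 10 ≤ L) :
    11 * L - 78 ≤ Real.exp (Real.log 2 * L / 2) := by
  have h2 := Real.log_two_gt_d9
  have h32 : Real.exp (5 * Real.log 2) = 32 := by
    rw [show (5 : ℝ) * Real.log 2 = ((5 : ℕ) : ℝ) * Real.log 2 by norm_num, Real.exp_nat_mul,
      Real.exp_log (by norm_num)]
    norm_num
  have hsplit : Real.exp (Real.log 2 * L / 2) = 32 * Real.exp (Real.log 2 * (L - 10) / 2) := by
    rw [← h32, ← Real.exp_add]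
    ring_nf
  have h1 := Real.add_one_le_exp (Real.log 2 * (L - 10) / 2)
  rw [hsplit]
  nlinarith [mul_nonneg (sub_nonneg.2 hL) (by linarith : (0 : ℝ) ≤ Real.log 2 - 11 / 16)]

/-- The local occupancy estimate for neighbourhoods spanning at most `3 t` edges. -/
theorem local_occupancy_of_sparse {t V L : ℝ} (ht : 1 ≤ t) (hL : 10 ≤ L)
    (hV : V = √t * Real.exp (Real.log 2 * L)) {U : Finset α}
    (hU : ((∑ u ∈ U, (U.filter fun y => G.Adj u y).card : ℕ) : ℝ) ≤ 6 * t) :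
    L / 5 * (1 / (4 * √t) + hardCoreSum G (1 / (4 * √t)) U) ≤
      V * (1 / (4 * √t)) +
        ∑ I ∈ indepSubsets G U, (I.card : ℝ) * (1 / (4 * √t)) ^ I.card := by
  have hs : 1 ≤ √t := Real.one_le_sqrt.2 ht
  have hsq : √t ^ 2 = t := Real.sq_sqrt (by linarith)
  set c := 1 / (4 * √t) with hcdef
  have hc : 0 < c := by positivity
  have hcs : c * √t = 1 / 4 := by rw [hcdef]; field_simp
  have hc4 : c ≤ 1 / 4 := by nlinarith
  have hct : c ^ 2 * (6 * t) = 3 / 8 := by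
    calc c ^ 2 * (6 * t) = 6 * (c * √t) ^ 2 := by rw [mul_pow, hsq]; ring
      _ = 3 / 8 := by rw [hcs]; norm_num
  set y := Real.exp (Real.log 2 * L / 2) with hy
  have hyL : 11 * L - 78 ≤ y := exp_half_log_two_mul_ge hL
  have hVc : V * c = y ^ 2 / 4 := by
    have : y ^ 2 = Real.exp (Real.log 2 * L) := by
      rw [hy, ← Real.exp_nat_mul]; push_cast; ring_nf
    rw [hV, this]
    linear_combination Real.exp (Real.log 2 * L) * hcs
  have hocc := le_sum_card_indepSubsets G hc hU
  set Z := hardCoreSum G c U with hZdef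
  have hZ : 0 < Z := hardCoreSum_pos G hc U
  set μ := c / (1 + c) with hμdef
  have hμ : 0 < μ := by positivity
  have hμc : μ * (1 + c) = c := by rw [hμdef]; field_simp
  have hμle : μ ≤ c := by nlinarith
  -- The choice of `c` makes the total loss from edges inside `U` a constant.
  have hμt : μ * (μ * (6 * t)) ≤ 3 / 8 := by
    rw [← hct]
    nlinarith [mul_le_mul hμle hμle hμ.le hc.le]
  set h := μ * (U.card - μ * (6 * t)) with hh
  have hh' : μ * U.card - 3 / 8 ≤ h := by rw [hh]; linarith
  have hLc : L / 5 * c ≤ L / 20 := by nlinarith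
  refine le_trans ?_ (add_le_add le_rfl hocc)
  rw [hVc, mul_add]
  -- Here `h` is the lower bound on the mean size of an independent subset of `U`. If it reaches `L
  -- / 5`, only `L / 5 * c` remains to be paid by `V * c`.
  rcases le_or_gt (L / 5) h with hcase | hcase
  · have := mul_le_mul_of_nonneg_right hcase hZ.le
    nlinarith
  · have hμx : 0 ≤ μ * U.card := by positivity
    -- From `μ |U| < L / 5 + 3 / 8` and `1 + c ≤ 5 / 4`. As `1 / 4 < log 2 / 2`, this keeps `Z` of
    -- order `y`, well below `V * c = y ^ 2 / 4`.
    have hcx : U.card * c ≤ L / 4 + 1 / 2 := by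
      have : (U.card : ℝ) * c = μ * U.card * (1 + c) := by linear_combination -(U.card : ℝ) * hμc
      rw [this]
      nlinarith
    have hZy : Z ≤ 2 * y := by
      calc Z ≤ (1 + c) ^ U.card := hardCoreSum_le_pow G hc U
        _ ≤ Real.exp c ^ U.card :=
            pow_le_pow_left₀ (by linarith) (by linarith [Real.add_one_le_exp c]) _
        _ = Real.exp (U.card * c) := (Real.exp_nat_mul _ _).symm
        _ ≤ Real.exp (Real.log 2 + Real.log 2 * L / 2) := by
            refine Real.exp_le_exp.2 (hcx.trans ?_)
            nlinarith [Real.log_two_gt_d9]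
        _ = 2 * y := by rw [Real.exp_add, Real.exp_log (by norm_num)]
    have h1 : (L / 5 - h) * Z ≤ (L / 5 + 3 / 8) * (2 * y) :=
      mul_le_mul (by linarith) hZy hZ.le (by linarith)
    have h2 : L / 20 + (L / 5 + 3 / 8) * (2 * y) ≤ y ^ 2 / 4 := by nlinarith
    linarith

/-- A maximal independent set dominates, so it is large when degrees are small. -/
theorem exists_indepSubset_card_le_mul {A : Finset α} {D : ℝ}
    (hD : ∀ v ∈ A, ((A.filter (G.Adj v)).card : ℝ) + 1 ≤ D) :
    ∃ S ∈ indepSubsets G A, (A.card : ℝ) ≤ D * S.card := by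
  obtain ⟨S, hS, hmax⟩ := (indepSubsets G A).exists_max_image Finset.card
    ⟨∅, empty_mem_indepSubsets G A⟩
  refine ⟨S, hS, ?_⟩
  obtain ⟨hSA, hSI⟩ := (mem_indepSubsets G).1 hS
  have hcov : A ⊆ S.biUnion fun v => insert v (A.filter (G.Adj v)) := by
    intro x hx
    by_contra hcon
    simp only [Finset.mem_biUnion, Finset.mem_insert, Finset.mem_filter, not_exists, not_and,
      not_or] at hcon
    have hxS : x ∉ S := fun h => (hcon x h).1 rfl
    have hins : insert x S ∈ indepSubsets G A := by
      rw [mem_indepSubsets]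
      refine ⟨Finset.insert_subset hx hSA, ?_⟩
      simp only [Finset.forall_mem_insert]
      exact ⟨⟨G.irrefl, fun y hy h => (hcon y hy).2 hx h.symm⟩, fun y hy =>
        ⟨(hcon y hy).2 hx, hSI y hy⟩⟩
    have := hmax _ hins
    rw [Finset.card_insert_of_notMem hxS] at this
    omega
  have h1 : (A.card : ℝ) ≤ ∑ v ∈ S, ((insert v (A.filter (G.Adj v))).card : ℝ) := by
    exact_mod_cast (Finset.card_le_card hcov).trans Finset.card_biUnion_le
  refine h1.trans ?_
  rw [mul_comm, ← nsmul_eq_mul]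
  refine Finset.sum_le_card_nsmul _ _ _ fun v hv => le_trans ?_ (hD v (hSA hv))
  exact_mod_cast Finset.card_insert_le _ _

/-- A graph with degrees below `V` in which every vertex lies in at most `3 t` triangles has an
independent set larger than the greedy bound by a factor of order `log (V / √t)`. -/
theorem exists_indepSubset_of_locally_sparse {A : Finset α} {t V : ℝ} (ht : 1 ≤ t) (hV : 0 < V)
    (hD : ∀ v ∈ A, ((A.filter (G.Adj v)).card : ℝ) + 1 ≤ V)
    (hT : ∀ v ∈ A, ((∑ u ∈ A.filter (G.Adj v),
      ((A.filter (G.Adj v)).filter fun y => G.Adj u y).card : ℕ) : ℝ) ≤ 6 * t) :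
    ∃ S ∈ indepSubsets G A,
      (A.card : ℝ) / V * ((Real.logb 2 V - Real.logb 2 √t) / 10) ≤ S.card := by
  set L := Real.logb 2 V - Real.logb 2 √t with hLdef
  have hs : 0 < √t := Real.sqrt_pos.2 (by linarith)
  -- For `L ≤ 10` the factor `L / 10` is at most `1`, so the greedy bound suffices.
  rcases le_or_gt L 10 with hL | hL
  · obtain ⟨S, hS, h⟩ := exists_indepSubset_card_le_mul G hD
    refine ⟨S, hS, ?_⟩
    have h1 : (A.card : ℝ) / V ≤ S.card := by rwa [div_le_iff₀ hV, mul_comm]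
    have h2 : (A.card : ℝ) / V * (L / 10) ≤ A.card / V * 1 :=
      mul_le_mul_of_nonneg_left (by linarith) (by positivity)
    linarith
  · have hVL : V = √t * Real.exp (Real.log 2 * L) := by
      have : Real.log 2 * L = Real.log V - Real.log √t := by
        have := (Real.log_pos one_lt_two).ne'
        rw [hLdef, Real.logb, Real.logb]
        field_simp
      rw [this, Real.exp_sub, Real.exp_log hV, Real.exp_log hs]
      field_simp
    obtain ⟨S, hS, h⟩ := exists_indepSubset_of_local_occupancy G (c := 1 / (4 * √t)) (a := V)
      (m := L / 5) (D := V) (A := A) (by positivity) (fun v hv => by linarith [hD v hv])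
      (fun v hv U hU => local_occupancy_of_sparse G ht hL.le hVL (le_trans (Nat.cast_le.2
        ((Finset.sum_le_sum fun u _ => Finset.card_le_card (Finset.filter_subset_filter _ hU)).trans
          (Finset.sum_le_sum_of_subset hU))) (hT v hv)))
    refine ⟨S, hS, ?_⟩
    rw [div_mul_eq_mul_div, div_le_iff₀ hV]
    linarith

end LocallySparse

/-! ### Counting in the Johnson scheme -/

section JohnsonScheme

/-- Two `w`-sets are adjacent when their Johnson distance is between `1` and `r`. -/
def johnsonBallGraph (ι : Type*) [DecidableEq ι] (r : ℕ) : SimpleGraph (Finset ι) where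
  Adj X Y := X ≠ Y ∧ (X \ Y).card ≤ r ∧ (Y \ X).card ≤ r
  symm := ⟨fun _ _ h => ⟨h.1.symm, h.2.2, h.2.1⟩⟩
  loopless := ⟨fun _ h => h.1 rfl⟩

instance (ι : Type*) [DecidableEq ι] (r : ℕ) : DecidableRel (johnsonBallGraph ι r).Adj :=
  fun X Y => inferInstanceAs (Decidable (X ≠ Y ∧ (X \ Y).card ≤ r ∧ (Y \ X).card ≤ r))

variable {n w : ℕ}

theorem card_johnson_sphere_le {X : Finset (Fin n)} (hX : X.card = w) (k : ℕ) :
    ((Finset.powersetCard w Finset.univ).filter fun Y => (X \ Y).card = k).card ≤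
      w.choose k * (n - w).choose k := by
  have hXc : Xᶜ.card = n - w := by rw [Finset.card_compl, Fintype.card_fin, hX]
  rw [← hX, ← Finset.card_powersetCard, hX, ← hXc, ← Finset.card_powersetCard,
    ← Finset.card_product]
  refine Finset.card_le_card_of_injOn (fun Y => (X \ Y, Y \ X)) ?_ ?_
  · intro Y hY
    simp only [Finset.coe_filter, Finset.mem_powersetCard, Set.mem_ofPred_eq] at hY
    simp only [Finset.mem_coe, Finset.mem_product, Finset.mem_powersetCard]
    refine ⟨⟨Finset.sdiff_subset, hY.2⟩, fun x hx => ?_, ?_⟩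
    · exact Finset.mem_compl.2 (Finset.mem_sdiff.1 hx).2
    · rw [← hY.2]
      exact Finset.card_sdiff_comm (hY.1.2.trans hX.symm)
  · intro Y _ Y' _ h
    simp only [Prod.mk.injEq, Finset.ext_iff, Finset.mem_sdiff] at h
    ext x
    have h1 := h.1 x
    have h2 := h.2 x
    tauto

/-- `X` and `Y` cut the ground set into four cells, and `Z` is determined by its traces on them.
With `l = |Z \ (X ∪ Y)|`, the set `Z` has `i - l` points in `Y \ X`, `j - l` in `X \ Y`, and misses
`i + j - k - l` of `X ∩ Y`. Only the upper bound is needed, so injectivity suffices. -/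
theorem card_johnson_sphere_inter_le {X Y : Finset (Fin n)} (hX : X.card = w) (hY : Y.card = w)
    (i j : ℕ) :
    ((Finset.powersetCard w Finset.univ).filter fun Z =>
      (X \ Z).card = i ∧ (Y \ Z).card = j).card ≤
      johnsonIntersection n w i j (X \ Y).card := by
  set k := (X \ Y).card with hk
  have hk' : (Y \ X).card = k := Finset.card_sdiff_comm (hY.trans hX.symm)
  have hXY : (X ∩ Y).card = w - k := by
    have := Finset.card_sdiff_add_card_inter X Y
    omega
  have hout : (X ∪ Y)ᶜ.card = n - w - k := by
    have h1 : (X ∪ Y).card = w + k := by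
      rw [← hX, ← hk', Finset.union_comm, ← Finset.card_sdiff_add_card Y X, add_comm]
    rw [Finset.card_compl, Fintype.card_fin, h1]
    omega
  have hcount : ∀ Z ∈ (Finset.powersetCard w Finset.univ).filter fun Z =>
      (X \ Z).card = i ∧ (Y \ Z).card = j,
      (Z \ (X ∪ Y)).card + (Z ∩ (Y \ X)).card = i ∧
      (Z \ (X ∪ Y)).card + (Z ∩ (X \ Y)).card = j ∧
      ((X ∩ Y) \ Z).card + k + (Z \ (X ∪ Y)).card = i + j ∧
      (Z ∩ (Y \ X)).card ≤ k ∧ (Z ∩ (X \ Y)).card ≤ k ∧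
      ((X ∩ Y) \ Z).card ≤ w - k ∧ (Z \ (X ∪ Y)).card ≤ n - w - k ∧ k ≤ w := by
    intro Z hZ
    simp only [Finset.mem_filter, Finset.mem_powersetCard] at hZ
    obtain ⟨⟨-, hZw⟩, hi, hj⟩ := hZ
    have e1 : (Z \ X).card = i := by
      rw [← hi]; exact Finset.card_sdiff_comm (hZw.trans hX.symm)
    have e2 : (Z \ Y).card = j := by
      rw [← hj]; exact Finset.card_sdiff_comm (hZw.trans hY.symm)
    have s1 : (Z \ X).card = (Z \ (X ∪ Y)).card + (Z ∩ (Y \ X)).card := by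
      rw [← Finset.card_union_of_disjoint]
      · congr 1; ext x; simp only [Finset.mem_sdiff, Finset.mem_union, Finset.mem_inter]; tauto
      · rw [Finset.disjoint_left]; intro x
        simp only [Finset.mem_sdiff, Finset.mem_union, Finset.mem_inter]; tauto
    have s2 : (Z \ Y).card = (Z \ (X ∪ Y)).card + (Z ∩ (X \ Y)).card := by
      rw [← Finset.card_union_of_disjoint]
      · congr 1; ext x; simp only [Finset.mem_sdiff, Finset.mem_union, Finset.mem_inter]; tauto
      · rw [Finset.disjoint_left]; intro x
        simp only [Finset.mem_sdiff, Finset.mem_union, Finset.mem_inter]; tauto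
    have s3 : (X \ Z).card + (Z ∩ (X \ Y)).card = ((X ∩ Y) \ Z).card + (X \ Y).card := by
      rw [← Finset.card_union_of_disjoint, ← Finset.card_union_of_disjoint]
      · congr 1; ext x; simp only [Finset.mem_sdiff, Finset.mem_union, Finset.mem_inter]; tauto
      all_goals
        rw [Finset.disjoint_left]; intro x
        simp only [Finset.mem_sdiff, Finset.mem_inter]; tauto
    have b1 : (Z ∩ (Y \ X)).card ≤ (Y \ X).card := Finset.card_le_card Finset.inter_subset_right
    have b2 : (Z ∩ (X \ Y)).card ≤ (X \ Y).card := Finset.card_le_card Finset.inter_subset_right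
    have b3 : ((X ∩ Y) \ Z).card ≤ (X ∩ Y).card := Finset.card_le_card Finset.sdiff_subset
    have b4 : (Z \ (X ∪ Y)).card ≤ (X ∪ Y)ᶜ.card :=
      Finset.card_le_card fun x hx => Finset.mem_compl.2 (Finset.mem_sdiff.1 hx).2
    have b5 : (X \ Y).card ≤ X.card := Finset.card_le_card Finset.sdiff_subset
    omega
  unfold johnsonIntersection
  split_ifs with hkij
  · rw [Finset.card_eq_sum_card_fiberwise (f := fun Z => (Z \ (X ∪ Y)).card)
      (t := Finset.Icc (max 0 (max (i - k) (max (j - k) (i + j - w))))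
        (min i (min j (min (i + j - k) (n - w - k)))))]
    · refine Finset.sum_le_sum fun l _ => ?_
      have hcard : (n - w - k).choose l * k.choose (i - l) * k.choose (j - l) *
          (w - k).choose (i + j - k - l) =
          (Finset.powersetCard l (X ∪ Y)ᶜ ×ˢ Finset.powersetCard (i - l) (Y \ X) ×ˢ
            Finset.powersetCard (j - l) (X \ Y) ×ˢ
            Finset.powersetCard (i + j - k - l) (X ∩ Y)).card := by
        simp only [Finset.card_product, Finset.card_powersetCard, hout, hXY, hk', ← hk]
        ring
      rw [hcard]
      refine Finset.card_le_card_of_injOn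
        (fun Z => (Z \ (X ∪ Y), Z ∩ (Y \ X), Z ∩ (X \ Y), (X ∩ Y) \ Z)) ?_ ?_
      · intro Z hZ
        rw [Finset.mem_coe, Finset.mem_filter] at hZ
        have := hcount Z hZ.1
        simp only [Finset.mem_coe, Finset.mem_product, Finset.mem_powersetCard]
        refine ⟨⟨fun x hx => Finset.mem_compl.2 (Finset.mem_sdiff.1 hx).2, hZ.2⟩,
          ⟨Finset.inter_subset_right, ?_⟩, ⟨Finset.inter_subset_right, ?_⟩,
          Finset.sdiff_subset, ?_⟩ <;> omega
      · intro Z _ Z' _ h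
        simp only [Prod.mk.injEq, Finset.ext_iff, Finset.mem_sdiff, Finset.mem_union,
          Finset.mem_inter] at h
        ext x
        have h1 := h.1 x
        have h2 := h.2.1 x
        have h3 := h.2.2.1 x
        have h4 := h.2.2.2 x
        revert h1 h2 h3 h4
        by_cases hxX : x ∈ X <;> by_cases hxY : x ∈ Y <;> simp [hxX, hxY, not_iff_not]
    · intro Z hZ
      have := hcount Z hZ
      simp only [Finset.coe_Icc, Set.mem_Icc]
      omega
  · rw [Nat.le_zero, Finset.card_eq_zero, Finset.filter_eq_empty_iff]
    intro Z hZ h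
    have := hcount Z (Finset.mem_filter.2 ⟨hZ, h⟩)
    omega

theorem one_le_card_sdiff {X Y : Finset (Fin n)} (h : X.card = Y.card) (hne : X ≠ Y) :
    1 ≤ (X \ Y).card := by
  rw [Nat.one_le_iff_ne_zero, Ne, Finset.card_eq_zero, Finset.sdiff_eq_empty_iff_subset]
  exact fun hs => hne (Finset.eq_of_subset_of_card_le hs h.ge)

theorem card_johnson_neighbors_succ_le {X : Finset (Fin n)}
    (hX : X ∈ Finset.powersetCard w Finset.univ) (r : ℕ) :
    ((Finset.powersetCard w Finset.univ).filter ((johnsonBallGraph (Fin n) r).Adj X)).card + 1 ≤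
      johnsonVolume n r w := by
  have hXw := (Finset.mem_powersetCard.1 hX).2
  -- The extra `1` is `X` itself, matching the summand at distance `0` in the volume.
  rw [← Finset.card_insert_of_notMem (a := X) (by simp)]
  rw [Finset.card_eq_sum_card_fiberwise (f := fun Y => (X \ Y).card) (t := Finset.range (r + 1))]
  · refine Finset.sum_le_sum fun k _ =>
      (Finset.card_le_card ?_).trans (card_johnson_sphere_le hXw k)
    intro Y hY
    simp only [Finset.mem_filter, Finset.mem_insert] at hY ⊢
    rcases hY with ⟨rfl | h, hk⟩
    · exact ⟨hX, hk⟩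
    · exact ⟨h.1, hk⟩
  · intro Y hY
    simp only [Finset.coe_insert, Finset.coe_filter, Set.mem_insert_iff, Set.mem_ofPred_eq] at hY
    rcases hY with rfl | h
    · simp
    · have := h.2.2.1
      simp only [Finset.coe_range, Set.mem_Iio]
      omega

theorem sum_card_johnson_triangles_le {X : Finset (Fin n)}
    (hX : X ∈ Finset.powersetCard w Finset.univ) (r : ℕ) :
    ∑ Y ∈ (Finset.powersetCard w Finset.univ).filter ((johnsonBallGraph (Fin n) r).Adj X),
      (((Finset.powersetCard w Finset.univ).filter ((johnsonBallGraph (Fin n) r).Adj X)).filter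
        fun Z => (johnsonBallGraph (Fin n) r).Adj Y Z).card ≤
      ∑ k ∈ Finset.Icc 1 r, w.choose k * (n - w).choose k *
        ∑ i ∈ Finset.Icc 1 r, ∑ j ∈ Finset.Icc 1 r, johnsonIntersection n w i j k := by
  have hXw := (Finset.mem_powersetCard.1 hX).2
  set N := (Finset.powersetCard w Finset.univ).filter ((johnsonBallGraph (Fin n) r).Adj X) with hN
  have hmem : ∀ Y ∈ N, Y.card = w ∧ (johnsonBallGraph (Fin n) r).Adj X Y := fun Y hY =>
    ⟨(Finset.mem_powersetCard.1 (Finset.mem_filter.1 hY).1).2, (Finset.mem_filter.1 hY).2⟩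
  have hdist : ∀ Y Z : Finset (Fin n), Y.card = w → Z.card = w →
      (johnsonBallGraph (Fin n) r).Adj Y Z → (Y \ Z).card ∈ Finset.Icc 1 r := fun Y Z hY hZ h =>
    Finset.mem_Icc.2 ⟨one_le_card_sdiff (hY.trans hZ.symm) h.1, h.2.1⟩
  have hinner : ∀ Y ∈ N, (N.filter fun Z => (johnsonBallGraph (Fin n) r).Adj Y Z).card ≤
      ∑ i ∈ Finset.Icc 1 r, ∑ j ∈ Finset.Icc 1 r,
        johnsonIntersection n w i j (X \ Y).card := by
    intro Y hY
    rw [← Finset.sum_product', Finset.card_eq_sum_card_fiberwise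
      (f := fun Z => ((X \ Z).card, (Y \ Z).card)) (t := Finset.Icc 1 r ×ˢ Finset.Icc 1 r)]
    · refine Finset.sum_le_sum fun p _ => (Finset.card_le_card ?_).trans
        (card_johnson_sphere_inter_le hXw (hmem Y hY).1 p.1 p.2)
      intro Z hZ
      simp only [Finset.mem_filter, hN] at hZ ⊢
      obtain ⟨⟨⟨hZ, -⟩, -⟩, rfl⟩ := hZ
      exact ⟨hZ, rfl, rfl⟩
    · intro Z hZ
      rw [Finset.mem_coe, Finset.mem_filter] at hZ
      have hZ' := hmem Z hZ.1
      exact Finset.mem_coe.2 (Finset.mem_product.2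
        ⟨hdist X Z hXw hZ'.1 hZ'.2, hdist Y Z (hmem Y hY).1 hZ'.1 hZ.2⟩)
  refine (Finset.sum_le_sum hinner).trans ?_
  rw [← Finset.sum_fiberwise_of_maps_to (g := fun Y => (X \ Y).card) (t := Finset.Icc 1 r)
    fun Y hY => hdist X Y hXw (hmem Y hY).1 (hmem Y hY).2]
  refine Finset.sum_le_sum fun k _ => ?_
  rw [Finset.sum_congr rfl fun Y hY => by rw [(Finset.mem_filter.1 hY).2], Finset.sum_const,
    smul_eq_mul]
  refine Nat.mul_le_mul_right _ ((Finset.card_le_card ?_).trans (card_johnson_sphere_le hXw k))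
  exact Finset.filter_subset_filter _ (Finset.filter_subset _ _)

theorem six_mul_johnsonE (n r w : ℕ) :
    6 * johnsonE n r w = ((∑ k ∈ Finset.Icc 1 r, w.choose k * (n - w).choose k *
      ∑ i ∈ Finset.Icc 1 r, ∑ j ∈ Finset.Icc 1 r, johnsonIntersection n w i j k : ℕ) : ℝ) := by
  unfold johnsonE
  push_cast
  simp_rw [Finset.mul_sum]
  symm
  refine Finset.sum_comm.trans (Finset.sum_congr rfl fun i _ => Finset.sum_comm.trans
    (Finset.sum_congr rfl fun j _ => Finset.sum_congr rfl fun k _ => ?_))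
  ring

/-- The summand `i = j = k = 1` is `w (n - w) (n - 2) ≥ 8`. This bound keeps the fugacity at most `1
/ 4`. -/
theorem one_le_johnsonE {r : ℕ} (hr : 1 ≤ r) (hw : 2 ≤ w) (hwn : 2 * w ≤ n) :
    1 ≤ johnsonE n r w := by
  have h1 : 1 ∈ Finset.Icc 1 r := by simp [hr]
  have hp : johnsonIntersection n w 1 1 1 = (w - 1) + (n - w - 1) := by
    have ha : max 0 (max (1 - 1) (max (1 - 1) (1 + 1 - w))) = 0 := by omega
    have hb : min 1 (min 1 (min (1 + 1 - 1) (n - w - 1))) = 1 := by omega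
    rw [johnsonIntersection, if_pos (by norm_num), ha, hb,
      show Finset.Icc 0 1 = {0, 1} from rfl, Finset.sum_pair (by norm_num)]
    simp
  have h6 : 6 ≤ ∑ k ∈ Finset.Icc 1 r, w.choose k * (n - w).choose k *
      ∑ i ∈ Finset.Icc 1 r, ∑ j ∈ Finset.Icc 1 r, johnsonIntersection n w i j k := by
    calc 6 ≤ w.choose 1 * (n - w).choose 1 * johnsonIntersection n w 1 1 1 := by
          rw [hp, Nat.choose_one_right, Nat.choose_one_right]
          calc 6 ≤ 2 * 2 * 2 := by norm_num
            _ ≤ _ := Nat.mul_le_mul (Nat.mul_le_mul hw (by omega)) (by omega)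
      _ ≤ w.choose 1 * (n - w).choose 1 *
          ∑ i ∈ Finset.Icc 1 r, ∑ j ∈ Finset.Icc 1 r, johnsonIntersection n w i j 1 := by
          refine Nat.mul_le_mul_left _ (le_trans ?_ (Finset.single_le_sum
            (f := fun i => ∑ j ∈ Finset.Icc 1 r, johnsonIntersection n w i j 1)
            (fun _ _ => Nat.zero_le _) h1))
          exact Finset.single_le_sum (f := fun j => johnsonIntersection n w 1 j 1)
            (fun _ _ => Nat.zero_le _) h1
      _ ≤ _ := Finset.single_le_sum (f := fun k => w.choose k * (n - w).choose k *
          ∑ i ∈ Finset.Icc 1 r, ∑ j ∈ Finset.Icc 1 r, johnsonIntersection n w i j k)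
          (fun _ _ => Nat.zero_le _) h1
  have : (6 : ℝ) ≤ 6 * johnsonE n r w := by
    rw [six_mul_johnsonE]
    exact_mod_cast h6
  linarith

end JohnsonScheme

/-! ### Binary words as supports -/

section Codes

variable {n : ℕ}

/-- The binary vector with the given support. -/
def indicatorVector (X : Finset (Fin n)) : Fin n → ZMod 2 := fun i => if i ∈ X then 1 else 0

theorem indicatorVector_injective : Function.Injective (indicatorVector (n := n)) := by
  intro X Y h
  ext x
  have := congrFun h x
  by_cases hX : x ∈ X <;> by_cases hY : x ∈ Y <;> simp_all [indicatorVector]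

theorem hammingNorm_indicatorVector (X : Finset (Fin n)) :
    hammingNorm (indicatorVector X) = X.card := by
  simp [hammingNorm, indicatorVector]

theorem hammingDist_indicatorVector (X Y : Finset (Fin n)) :
    hammingDist (indicatorVector X) (indicatorVector Y) = (X \ Y).card + (Y \ X).card := by
  rw [← Finset.card_union_of_disjoint disjoint_sdiff_sdiff, hammingDist]
  refine congrArg Finset.card (Finset.ext fun x => Finset.mem_filter.trans ?_)
  by_cases hX : x ∈ X <;> by_cases hY : x ∈ Y <;> simp [indicatorVector, hX, hY]

theorem constWeightVectors_eq_image (w : ℕ) :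
    constWeightVectors n w = (Finset.powersetCard w Finset.univ).image indicatorVector := by
  ext x
  simp only [constWeightVectors, Finset.mem_filter, Finset.mem_univ, true_and, Finset.mem_image,
    Finset.mem_powersetCard, Finset.subset_univ]
  constructor
  · intro hx
    refine ⟨Finset.univ.filter fun i => x i ≠ 0, hx, ?_⟩
    ext1 i
    have h01 : ∀ a : ZMod 2, (if a ≠ 0 then (1 : ZMod 2) else 0) = a := by decide
    simpa [indicatorVector] using h01 (x i)
  · rintro ⟨X, hX, rfl⟩
    rw [hammingNorm_indicatorVector, hX]

theorem card_constWeightVectors (w : ℕ) :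
    (constWeightVectors n w).card =
      (Finset.powersetCard w (Finset.univ : Finset (Fin n))).card := by
  rw [constWeightVectors_eq_image, Finset.card_image_of_injective _ indicatorVector_injective]

theorem card_le_maxConstWeightCode {w d : ℕ} (hd : 1 ≤ d) {S : Finset (Finset (Fin n))}
    (hS : S ∈ indepSubsets (johnsonBallGraph (Fin n) (d - 1))
      (Finset.powersetCard w Finset.univ)) :
    S.card ≤ maxConstWeightCode n (2 * d) w := by
  obtain ⟨hSA, hSI⟩ := (mem_indepSubsets _).1 hS
  rw [← Finset.card_image_of_injective S indicatorVector_injective]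
  refine Finset.le_sup (f := Finset.card) (Finset.mem_filter.2 ⟨Finset.mem_univ _, ?_, ?_⟩)
  · rw [constWeightVectors_eq_image]
    exact Finset.image_subset_image hSA
  · simp only [Finset.forall_mem_image]
    intro X hX Y hY hne
    have hXY : X ≠ Y := fun h => hne (h ▸ rfl)
    have hcard : (Y \ X).card = (X \ Y).card := Finset.card_sdiff_comm
      ((Finset.mem_powersetCard.1 (hSA hY)).2.trans (Finset.mem_powersetCard.1 (hSA hX)).2.symm)
    -- For sets of equal size the Hamming distance is `2 |X \ Y|`, so non-adjacency gives at least
    -- `2d`.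
    have hnot : ¬ ((X \ Y).card ≤ d - 1) := fun h =>
      hSI X hX Y hY ⟨hXY, h, hcard.trans_le h⟩
    rw [hammingDist_indicatorVector]
    omega

end Codes

theorem mainTheorem7 (n d w : ℕ) (hd : 2 ≤ d) (hdw : d ≤ w) (hwn : 2 * w ≤ n) :
    (maxConstWeightCode n (2 * d) w : ℝ) ≥
      ((constWeightVectors n w).card : ℝ) / (johnsonVolume n (d - 1) w : ℝ) *
        ((Real.logb 2 (johnsonVolume n (d - 1) w : ℝ)
            - Real.logb 2 (Real.sqrt (johnsonE n (d - 1) w))) / 10) := by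
  have hV : 0 < johnsonVolume n (d - 1) w :=
    Finset.sum_pos' (fun _ _ => Nat.zero_le _) ⟨0, by simp, by simp⟩
  obtain ⟨S, hS, h⟩ := exists_indepSubset_of_locally_sparse (johnsonBallGraph (Fin n) (d - 1))
    (A := Finset.powersetCard w Finset.univ) (t := johnsonE n (d - 1) w)
    (V := johnsonVolume n (d - 1) w)
    (one_le_johnsonE (by omega) (by omega) hwn) (by exact_mod_cast hV)
    (fun X hX => by exact_mod_cast card_johnson_neighbors_succ_le hX (d - 1))
    (fun X hX => by
      rw [six_mul_johnsonE]
      exact_mod_cast sum_card_johnson_triangles_le hX (d - 1))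
  rw [card_constWeightVectors]
  exact h.trans (by exact_mod_cast card_le_maxConstWeightCode (by omega) hS)
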